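/- Let $X$ be a real normed space (for instance a Banach space), let $T:X\to X$ be nonexpansive, i.e. $\|Tx-Ty\|\le\|x-y\|$ for all $x,y\in X$, let $f:[0,\infty)\to X$ be continuous, let $x_0\in X$, and let $u:[0,\infty)\to X$ be a differentiable function (one-sided derivative at $t=0$) satisfying $$u'(t)+(I-T)u(t)=f(t)\quad (t\ge 0),\qquad u(0)=x_0 .$$ Let $\epsilon:[0,\infty)\to\mathbb{R}$ be a continuous function with $\epsilon(t)\ge\|f(t)\|$ for all $t\ge 0$, and let $\sigma(y)=\min\{1,1/\sqrt{\pi y}\}$ for $y>0$ and $\sigma(0)=1$. Write $\mathrm{Fix}(T)=\{x\in X: Tx=x\}$. Assume that one of the following two conditions holds, and let $\kappa$ be the corresponding constant: (H2') $T$ has bounded range, and $\kappa=\sup\{\|Tx-x_0\|:x\in X\}$; or (H2'') $\mathrm{Fix}(T)\neq\emptyset$, $\epsilon$ is nonincreasing with $S=\int_0^\infty\epsilon(t)\,dt<\infty$, and $\kappa=2\,\mathrm{dist}(x_0,\mathrm{Fix}(T))+S$. Then for all $t\ge 0$ $$\|u'(t)\|\le \kappa\,\sigma(t)+\int_0^t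 2\,\epsilon(s)\,\sigma(t-s)\,ds+\epsilon(t).$$ Moreover, if $\epsilon(t)\to 0$ as $t\to\infty$ and $\int_0^\infty\epsilon(s)\,ds<\infty$, then $\|u'(t)\|\to 0$ as $t\to\infty$. -/

import Mathlib

open Set Filter Topology MeasureTheory

noncomputable section

/-- The function `σ(y) = min {1, 1/√(π y)}` on `[0, ∞)`, where `1/0` is read as `+∞`, so that
`σ(0) = 1`. (Values at negative arguments are irrelevant and set to `1`.) -/
def sigmaFn (y : ℝ) : ℝ :=
  if y ≤ 0 then 1 else min 1 (1 / Real.sqrt (Real.pi * y))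

/-- `u : [0, ∞) → X` solves `u'(t) + (I - T) u(t) = f(t)` for all `t ≥ 0`, with `u(0) = x₀`.
The derivative is taken within `[0, ∞)`, so it is one-sided at `t = 0` and the usual two-sided
derivative at each `t > 0`. -/
structure IsEvolutionSolution {X : Type*} [NormedAddCommGroup X] [NormedSpace ℝ X]
    (T : X → X) (f : ℝ → X) (x₀ : X) (u : ℝ → X) : Prop where
  differentiableOn : DifferentiableOn ℝ u (Ici 0)
  equation : ∀ t : ℝ, 0 ≤ t → derivWithin u (Ici 0) t + (u t - T (u t)) = f t
  initial : u 0 = x₀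

/-- `T` has bounded range, and `κ = sup {‖T x - x₀‖ : x ∈ X}`. -/
structure BoundedRangeCondition {X : Type*} [NormedAddCommGroup X]
    (T : X → X) (x₀ : X) (κ : ℝ) : Prop where
  bounded_range : Bornology.IsBounded (range T)
  kappa_eq : κ = ⨆ x : X, ‖T x - x₀‖

/-- `Fix(T) ≠ ∅`, the function `ε` is decreasing (nonincreasing) on `[0, ∞)` with
`S = ∫₀^∞ ε(t) dt < ∞`, and `κ = 2 dist(x₀, Fix(T)) + S`. -/
structure FixedPointCondition {X : Type*} [NormedAddCommGroup X]
    (T : X → X) (x₀ : X) (ε : ℝ → ℝ) (κ : ℝ) : Prop where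
  fix_nonempty : (Function.fixedPoints T).Nonempty
  antitoneOn : AntitoneOn ε (Ici 0)
  integrableOn : IntegrableOn ε (Ioi 0)
  kappa_eq : κ = 2 * Metric.infDist x₀ (Function.fixedPoints T) + ∫ t in Ioi (0 : ℝ), ε t

end

/-! Since `u' = T u - u + f`, it suffices to bound `‖T (u t) - u t‖`, and this is done off the
diagonal. For `0 ≤ s ≤ t`, the quantities `‖u t - u s‖` and `‖T (u t) - u s‖` are compared with the
solution of the linear system `D_t = G - D + ε(t)`, `G_s = D - G + ε(s)`, with `D = 0` on the
diagonal and `G(0,t) = κ + ∫₀ᵗ ε`. Nonexpansiveness makes the two norms a subsolution, so a maximum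
principle on the triangle gives `norm_sub_le_boundG`.

The system is solved explicitly. The functions `exp(-(s+t) + z t + s/z)` with `z = exp(iθ)` solve
the homogeneous equations; dividing imaginary parts by `sin θ`, weighting by `1 + cos θ` and
integrating over `[0, π]` matches the boundary data (`integral_kernG_zero`). The source `ε` enters
by Duhamel's principle. On the diagonal `G` becomes a Gaussian-type integral bounded by `π σ`
(`integral_kernG_self_le`), which yields the estimate at `s = t`. -/

/-- Differentiation under an interval integral with jointly continuous derivative. -/
theorem hasDerivAt_intervalIntegral_of_continuous {F F' : ℝ → ℝ → ℝ}
    (hF : Continuous (Function.uncurry F)) (hF' : Continuous (Function.uncurry F'))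
    (h : ∀ x θ, HasDerivAt (fun y => F y θ) (F' x θ) x) (a b x : ℝ) :
    HasDerivAt (fun y => ∫ θ in a..b, F y θ) (∫ θ in a..b, F' x θ) x := by
  have hK : IsCompact (Icc (x - 1) (x + 1) ×ˢ uIcc a b) := isCompact_Icc.prod isCompact_uIcc
  obtain ⟨C, hC⟩ := hK.exists_bound_of_continuousOn hF'.continuousOn
  have hFx : ∀ y, Continuous (F y) := fun y => hF.comp (Continuous.prodMk_right y)
  have hFx' : ∀ y, Continuous (F' y) := fun y => hF'.comp (Continuous.prodMk_right y)
  refine (intervalIntegral.hasDerivAt_integral_of_dominated_loc_of_deriv_le (μ := volume)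
    (bound := fun _ => C) (Icc_mem_nhds (by linarith : x - 1 < x) (by linarith : x < x + 1))
    (Eventually.of_forall fun y => (hFx y).aestronglyMeasurable)
    ((hFx x).intervalIntegrable _ _) (hFx' x).aestronglyMeasurable ?_
    intervalIntegrable_const ?_).2
  · exact Eventually.of_forall fun θ hθ y hy => hC (y, θ) ⟨hy, uIoc_subset_uIcc hθ⟩
  · exact Eventually.of_forall fun θ _ y _ => h y θ

/-! ### Kernels solving the homogeneous comparison system. -/

/-- The function `sin (a sin θ) / sin θ`, extended continuously to the zeros of `sin θ`. -/
noncomputable def sinQuot (a θ : ℝ) : ℝ := a * Real.sinc (a * Real.sin θ)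

@[fun_prop]
theorem continuous_real_sinc_comp {α : Type*} [TopologicalSpace α] {g : α → ℝ}
    (hg : Continuous g) : Continuous fun x => Real.sinc (g x) :=
  Real.continuous_sinc.comp hg

@[simp] theorem sinQuot_zero (θ : ℝ) : sinQuot 0 θ = 0 := by simp [sinQuot]

theorem sin_mul_sinQuot (a θ : ℝ) : Real.sin θ * sinQuot a θ = Real.sin (a * Real.sin θ) := by
  unfold sinQuot Real.sinc
  split_ifs with h
  · rw [h, Real.sin_zero]; linarith
  · rw [← mul_assoc, mul_comm (Real.sin θ) a, mul_div_cancel₀ _ h]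

theorem hasDerivAt_sinQuot (a θ : ℝ) :
    HasDerivAt (fun b => sinQuot b θ) (Real.cos (a * Real.sin θ)) a := by
  by_cases h : Real.sin θ = 0
  · simpa [sinQuot, h] using hasDerivAt_id' a
  · have e : (fun b => sinQuot b θ) = fun b => Real.sin (b * Real.sin θ) / Real.sin θ := by
      funext b
      rw [eq_div_iff h, mul_comm, sin_mul_sinQuot]
    rw [e]
    have := (((hasDerivAt_id a).mul_const (Real.sin θ)).sin).div_const (Real.sin θ)
    simpa [h] using this

/-- Kernel of the integral representation of the comparison bound for `‖u t - u s‖`. -/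
noncomputable def kernD (s t θ : ℝ) : ℝ :=
  Real.exp (-(s + t) * (1 - Real.cos θ)) * ((1 + Real.cos θ) * sinQuot (t - s) θ)

/-- Kernel of the integral representation of the comparison bound for `‖T (u t) - u s‖`. -/
noncomputable def kernG (s t θ : ℝ) : ℝ :=
  Real.exp (-(s + t) * (1 - Real.cos θ)) * ((1 + Real.cos θ) *
    (Real.cos θ * sinQuot (t - s) θ + Real.cos ((t - s) * Real.sin θ)))

@[fun_prop]
theorem continuous_kernD {α : Type*} [TopologicalSpace α] {f g h : α → ℝ}
    (hf : Continuous f) (hg : Continuous g) (hh : Continuous h) :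
    Continuous fun x => kernD (f x) (g x) (h x) := by
  unfold kernD sinQuot
  fun_prop

@[fun_prop]
theorem continuous_kernG {α : Type*} [TopologicalSpace α] {f g h : α → ℝ}
    (hf : Continuous f) (hg : Continuous g) (hh : Continuous h) :
    Continuous fun x => kernG (f x) (g x) (h x) := by
  unfold kernG sinQuot
  fun_prop

/-- With `z = exp(iθ)`, the operator `∂_t + 1` multiplies the underlying exponential by `z`, turning
`kernD` into `kernG`; in `hasDerivAt_kernG`, `∂_s + 1` multiplies by `1/z` and turns it back. -/
theorem hasDerivAt_kernD (s t θ : ℝ) :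
    HasDerivAt (fun x => kernD s x θ) (kernG s t θ - kernD s t θ) t := by
  have h1 : HasDerivAt (fun x => Real.exp (-(s + x) * (1 - Real.cos θ)))
      (Real.exp (-(s + t) * (1 - Real.cos θ)) * (-1 * (1 - Real.cos θ))) t :=
    ((((hasDerivAt_id t).const_add s).neg).mul_const _).exp
  have h2 : HasDerivAt (fun x => sinQuot (x - s) θ) (Real.cos ((t - s) * Real.sin θ)) t :=
    (hasDerivAt_sinQuot (t - s) θ).comp_sub_const t s
  refine (h1.mul (h2.const_mul (1 + Real.cos θ))).congr_deriv ?_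
  unfold kernG kernD
  ring

theorem hasDerivAt_kernG (s t θ : ℝ) :
    HasDerivAt (fun x => kernG x t θ) (kernD s t θ - kernG s t θ) s := by
  have h1 : HasDerivAt (fun x => Real.exp (-(x + t) * (1 - Real.cos θ)))
      (Real.exp (-(s + t) * (1 - Real.cos θ)) * (-1 * (1 - Real.cos θ))) s :=
    ((((hasDerivAt_id s).add_const t).neg).mul_const _).exp
  have h2 : HasDerivAt (fun x => sinQuot (t - x) θ) (-Real.cos ((t - s) * Real.sin θ)) s :=
    (hasDerivAt_sinQuot (t - s) θ).comp_const_sub t s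
  have h3 : HasDerivAt (fun x => Real.cos ((t - x) * Real.sin θ))
      (-Real.sin ((t - s) * Real.sin θ) * (-1 * Real.sin θ)) s :=
    (((hasDerivAt_id s).const_sub t).mul_const _).cos
  refine (h1.mul (((h2.const_mul (Real.cos θ)).add h3).const_mul (1 + Real.cos θ))).congr_deriv ?_
  simp only [Pi.add_apply]
  rw [← sin_mul_sinQuot]
  unfold kernG kernD
  linear_combination Real.exp (-(s + t) * (1 - Real.cos θ)) * ((1 + Real.cos θ) *
    sinQuot (t - s) θ) * (Real.sin_sq_add_cos_sq θ)

theorem hasDerivAt_kernG_zero (a θ : ℝ) :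
    HasDerivAt (fun x => kernG 0 x θ) (Real.exp (-a * (1 - Real.cos θ)) *
      ((2 * Real.cos θ ^ 2 + Real.cos θ - 1) * Real.cos (a * Real.sin θ)
        - (1 + 2 * Real.cos θ) * Real.sin θ * Real.sin (a * Real.sin θ))) a := by
  have h1 : HasDerivAt (fun x => Real.exp (-x * (1 - Real.cos θ)))
      (Real.exp (-a * (1 - Real.cos θ)) * (-1 * (1 - Real.cos θ))) a :=
    (((hasDerivAt_id a).neg).mul_const _).exp
  have h2 := hasDerivAt_sinQuot a θ
  have h3 : HasDerivAt (fun x => Real.cos (x * Real.sin θ))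
      (-Real.sin (a * Real.sin θ) * (1 * Real.sin θ)) a :=
    ((hasDerivAt_id a).mul_const _).cos
  have h4 := h1.mul (((h2.const_mul (Real.cos θ)).add h3).const_mul (1 + Real.cos θ))
  have e : (fun x => kernG 0 x θ) = (fun x => Real.exp (-x * (1 - Real.cos θ))) * fun x =>
      (1 + Real.cos θ) * ((fun x => Real.cos θ * sinQuot x θ) + fun x =>
        Real.cos (x * Real.sin θ)) x := by
    funext x
    simp [kernG]
  rw [e]
  refine h4.congr_deriv ?_
  simp only [Pi.add_apply]
  rw [← sin_mul_sinQuot]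
  linear_combination Real.exp (-a * (1 - Real.cos θ)) * Real.cos θ *
    sinQuot a θ * (Real.sin_sq_add_cos_sq θ)

theorem integral_deriv_kernG_zero (a : ℝ) :
    ∫ θ in (0 : ℝ)..Real.pi, (Real.exp (-a * (1 - Real.cos θ)) *
      ((2 * Real.cos θ ^ 2 + Real.cos θ - 1) * Real.cos (a * Real.sin θ)
        - (1 + 2 * Real.cos θ) * Real.sin θ * Real.sin (a * Real.sin θ))) = 0 := by
  rcases eq_or_ne a 0 with rfl | ha
  · have key : ∀ θ ∈ uIcc 0 Real.pi, HasDerivAt (fun θ => Real.sin θ * (Real.cos θ + 1))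
        (2 * Real.cos θ ^ 2 + Real.cos θ - 1) θ := by
      intro θ _
      refine ((Real.hasDerivAt_sin θ).mul ((Real.hasDerivAt_cos θ).add_const 1)).congr_deriv ?_
      linear_combination -Real.sin_sq_add_cos_sq θ
    have h := intervalIntegral.integral_eq_sub_of_hasDerivAt key
      (Continuous.intervalIntegrable (by fun_prop) _ _)
    simpa using h
  -- Explicit antiderivative; its denominator `a ^ 2` is why `a = 0` is treated apart.
  have key : ∀ θ ∈ uIcc 0 Real.pi, HasDerivAt (fun θ => Real.exp (-a * (1 - Real.cos θ)) *
      ((a * (1 + Real.cos θ) - 1) * Real.sin (a * Real.sin θ)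
        + a * Real.sin θ * Real.cos (a * Real.sin θ)) / a ^ 2)
      (Real.exp (-a * (1 - Real.cos θ)) *
      ((2 * Real.cos θ ^ 2 + Real.cos θ - 1) * Real.cos (a * Real.sin θ)
        - (1 + 2 * Real.cos θ) * Real.sin θ * Real.sin (a * Real.sin θ))) θ := by
    intro θ _
    have hs := Real.hasDerivAt_sin θ
    have hc := Real.hasDerivAt_cos θ
    have h1 := ((hc.const_sub 1).const_mul (-a)).exp
    have h2 := ((hc.const_add 1).const_mul a).sub_const 1
    have h3 := (hs.const_mul a).sin
    have h4 := (hs.const_mul a).cos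
    refine ((h1.mul ((h2.mul h3).add ((hs.const_mul a).mul h4))).div_const (a ^ 2)).congr_deriv ?_
    rw [div_eq_iff (pow_ne_zero 2 ha)]
    simp only [Pi.add_apply, Pi.mul_apply]
    have h5 := Real.sin_sq_add_cos_sq θ
    linear_combination (-a ^ 2 * Real.exp (-a * (1 - Real.cos θ)) * Real.cos (a * Real.sin θ)) * h5
  rw [intervalIntegral.integral_eq_sub_of_hasDerivAt key
    (Continuous.intervalIntegrable (by fun_prop) _ _)]
  simp

/-- The weight `1 + cos θ` makes the `a`-derivative of the integrand an exact `θ`-derivative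
vanishing at both ends, so the integral keeps its value at `a = 0`. This gives the constant boundary
value on `s = 0`. -/
theorem integral_kernG_zero (a : ℝ) :
    ∫ θ in (0 : ℝ)..Real.pi, kernG 0 a θ = Real.pi := by
  have hd : ∀ x : ℝ, HasDerivAt (fun y => ∫ θ in (0 : ℝ)..Real.pi, kernG 0 y θ) 0 x := fun x =>
    (hasDerivAt_intervalIntegral_of_continuous (by unfold Function.uncurry; fun_prop)
      (by unfold Function.uncurry; fun_prop) hasDerivAt_kernG_zero 0 Real.pi x).congr_deriv
      (integral_deriv_kernG_zero x)
  have hconst := is_const_of_deriv_eq_zero (fun x => (hd x).differentiableAt)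
    (fun x => (hd x).deriv) a 0
  rw [hconst]
  have : ∀ θ, kernG 0 0 θ = 1 + Real.cos θ := by intro θ; simp [kernG]
  simp [this]

/-! ### The function `σ` and the kernel on the diagonal. -/

theorem sigmaFn_eq (y : ℝ) : sigmaFn y = (Real.sqrt (max 1 (Real.pi * y)))⁻¹ := by
  unfold sigmaFn
  have hp := Real.pi_pos
  split_ifs with h
  · rw [max_eq_left (by nlinarith)]
    simp
  · rw [one_div]
    push Not at h
    have h0 : 0 < Real.pi * y := by positivity
    have h1 : 0 < Real.sqrt (Real.pi * y) := Real.sqrt_pos.2 h0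
    rcases le_total 1 (Real.pi * y) with h' | h'
    · rw [max_eq_right h', min_eq_right]
      exact inv_le_one_of_one_le₀ (by rwa [Real.one_le_sqrt])
    · rw [max_eq_left h', Real.sqrt_one, inv_one, min_eq_left]
      exact (one_le_inv₀ h1).2 (Real.sqrt_le_one.2 h')

@[fun_prop]
theorem continuous_sigmaFn_comp {α : Type*} [TopologicalSpace α] {g : α → ℝ}
    (hg : Continuous g) : Continuous fun x => sigmaFn (g x) := by
  simp only [sigmaFn_eq]
  refine Continuous.inv₀ (by fun_prop) fun x => ?_
  exact (Real.sqrt_pos.2 (lt_max_of_lt_left one_pos)).ne'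

theorem sigmaFn_nonneg (y : ℝ) : 0 ≤ sigmaFn y := by
  rw [sigmaFn_eq]
  positivity

theorem sigmaFn_le_one (y : ℝ) : sigmaFn y ≤ 1 := by
  rw [sigmaFn_eq]
  exact inv_le_one_of_one_le₀ (by rw [Real.one_le_sqrt]; exact le_max_left _ _)

theorem tendsto_sigmaFn : Tendsto sigmaFn atTop (𝓝 0) := by
  have : sigmaFn = fun y => (Real.sqrt (max 1 (Real.pi * y)))⁻¹ := funext sigmaFn_eq
  rw [this]
  refine tendsto_inv_atTop_zero.comp (Real.tendsto_sqrt_atTop.comp ?_)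
  exact tendsto_atTop_mono (fun y => le_max_right _ _) (tendsto_id.const_mul_atTop Real.pi_pos)

theorem kernG_self (t θ : ℝ) :
    kernG t t θ = Real.exp (-(t + t) * (1 - Real.cos θ)) * (1 + Real.cos θ) := by
  simp [kernG]

theorem integral_kernG_self_le_pi {t : ℝ} (ht : 0 ≤ t) :
    ∫ θ in (0 : ℝ)..Real.pi, kernG t t θ ≤ Real.pi := by
  have h : ∫ θ in (0 : ℝ)..Real.pi, kernG t t θ ≤ ∫ θ in (0 : ℝ)..Real.pi, (1 + Real.cos θ) := by
    refine intervalIntegral.integral_mono_on Real.pi_pos.le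
      (Continuous.intervalIntegrable (by fun_prop) _ _)
      (Continuous.intervalIntegrable (by fun_prop) _ _) fun θ _ => ?_
    rw [kernG_self]
    refine mul_le_of_le_one_left (by linarith [Real.neg_one_le_cos θ]) (Real.exp_le_one_iff.2 ?_)
    nlinarith [Real.cos_le_one θ]
  refine h.trans_eq ?_
  simp

/-- Substitute `x = 2 sin(θ/2)`: then `2t(1 - cos θ) = t x²`, and `1 + cos θ = 2 cos²(θ/2) ≤ 2
cos(θ/2)` supplies `2 dx`. Extending `[0, 2]` to the half-line gives the Gaussian integral. -/
theorem integral_kernG_self_le_gaussian {t : ℝ} (ht : 0 < t) :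
    ∫ θ in (0 : ℝ)..Real.pi, kernG t t θ ≤ Real.sqrt (Real.pi / t) := by
  have hsub : ∫ θ in (0 : ℝ)..Real.pi,
      ((fun x => 2 * Real.exp (-t * x ^ 2)) ∘ fun θ => 2 * Real.sin (θ / 2)) θ * Real.cos (θ / 2)
      = ∫ x in (2 * Real.sin (0 / 2))..(2 * Real.sin (Real.pi / 2)), 2 * Real.exp (-t * x ^ 2) := by
    refine intervalIntegral.integral_comp_mul_deriv (fun θ _ => ?_)
      (by fun_prop) (by fun_prop)
    refine ((((hasDerivAt_id θ).div_const 2).sin).const_mul 2).congr_deriv ?_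
    simp only [id]
    ring
  have hle : ∫ θ in (0 : ℝ)..Real.pi, kernG t t θ ≤ ∫ θ in (0 : ℝ)..Real.pi,
      ((fun x => 2 * Real.exp (-t * x ^ 2)) ∘ fun θ => 2 * Real.sin (θ / 2)) θ
        * Real.cos (θ / 2) := by
    refine intervalIntegral.integral_mono_on Real.pi_pos.le
      (Continuous.intervalIntegrable (by fun_prop) _ _)
      (Continuous.intervalIntegrable (by fun_prop) _ _) fun θ hθ => ?_
    have hc : Real.cos θ = 2 * Real.cos (θ / 2) ^ 2 - 1 := by
      rw [← Real.cos_two_mul, mul_div_cancel₀ θ two_ne_zero]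
    have hcs := Real.sin_sq_add_cos_sq (θ / 2)
    have h0 : 0 ≤ Real.cos (θ / 2) :=
      Real.cos_nonneg_of_mem_Icc ⟨by linarith [hθ.1, Real.pi_pos], by linarith [hθ.2]⟩
    have he : -(t + t) * (1 - Real.cos θ) = -t * (2 * Real.sin (θ / 2)) ^ 2 := by
      rw [hc]
      linear_combination (4 * t) * hcs
    rw [kernG_self, he, Function.comp_apply, mul_comm (2 : ℝ) (Real.exp _), mul_assoc]
    refine mul_le_mul_of_nonneg_left ?_ (Real.exp_pos _).le
    rw [hc]
    nlinarith [Real.cos_le_one (θ / 2)]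
  refine hle.trans ?_
  rw [hsub]
  simp only [zero_div, Real.sin_zero, mul_zero, Real.sin_pi_div_two, mul_one]
  rw [intervalIntegral.integral_const_mul, intervalIntegral.integral_of_le (by norm_num)]
  have hg := integral_gaussian_Ioi t
  have := setIntegral_mono_set (μ := volume) (s := Ioc (0 : ℝ) 2) (t := Ioi 0)
    (f := fun x => Real.exp (-t * x ^ 2)) (integrable_exp_neg_mul_sq ht).integrableOn
    (Eventually.of_forall fun x => (Real.exp_pos _).le) (Ioc_subset_Ioi_self.eventuallyLE)
  linarith

theorem integral_kernG_self_le {t : ℝ} (ht : 0 ≤ t) :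
    ∫ θ in (0 : ℝ)..Real.pi, kernG t t θ ≤ Real.pi * sigmaFn t := by
  unfold sigmaFn
  split_ifs with h
  · simpa using integral_kernG_self_le_pi ht
  · push Not at h
    rw [mul_min_of_nonneg _ _ Real.pi_pos.le]
    refine le_min (by simpa using integral_kernG_self_le_pi ht)
      ((integral_kernG_self_le_gaussian h).trans_eq ?_)
    rw [Real.sqrt_div Real.pi_pos.le, Real.sqrt_mul Real.pi_pos.le]
    have h1 := Real.sqrt_pos.2 h
    have h2 := Real.sqrt_pos.2 Real.pi_pos
    field_simp
    exact Real.sq_sqrt Real.pi_pos.le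

/-! ### Comparison bounds with the source term. -/

/-- Weight carrying the initial discrepancy `κ` and the accumulated perturbation. -/
noncomputable def kernWeight (κ : ℝ) (ε : ℝ → ℝ) (s θ : ℝ) : ℝ :=
  κ + 2 * ∫ τ in (0 : ℝ)..s, ε τ * Real.exp ((τ + τ) * (1 - Real.cos θ))

/-- Comparison bound for `‖u t - u s‖`. -/
noncomputable def boundD (κ : ℝ) (ε : ℝ → ℝ) (s t : ℝ) : ℝ :=
  (∫ θ in (0 : ℝ)..Real.pi, kernD s t θ * kernWeight κ ε s θ) / Real.pi
    + ((∫ τ in (0 : ℝ)..t, ε τ) - ∫ τ in (0 : ℝ)..s, ε τ)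

/-- Comparison bound for `‖T (u t) - u s‖`. -/
noncomputable def boundG (κ : ℝ) (ε : ℝ → ℝ) (s t : ℝ) : ℝ :=
  (∫ θ in (0 : ℝ)..Real.pi, kernG s t θ * kernWeight κ ε s θ) / Real.pi
    + ((∫ τ in (0 : ℝ)..t, ε τ) - ∫ τ in (0 : ℝ)..s, ε τ)

theorem continuous_kernWeight (κ : ℝ) {ε : ℝ → ℝ} (hε : Continuous ε) {α : Type*}
    [TopologicalSpace α] {f g : α → ℝ} (hf : Continuous f) (hg : Continuous g) :
    Continuous fun x => kernWeight κ ε (f x) (g x) := by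
  have : Continuous fun p : ℝ × ℝ => kernWeight κ ε p.1 p.2 := by
    simp only [kernWeight]
    refine continuous_const.add (continuous_const.mul ?_)
    have hc : Continuous (Function.uncurry fun (p : ℝ × ℝ) (τ : ℝ) =>
        ε τ * Real.exp ((τ + τ) * (1 - Real.cos p.2))) := by
      simp only [Function.uncurry_def]
      fun_prop
    exact intervalIntegral.continuous_parametric_intervalIntegral_of_continuous
      (μ := volume) (a₀ := 0) (s := Prod.fst) hc continuous_fst
  exact Continuous.comp (g := fun p : ℝ × ℝ => kernWeight κ ε p.1 p.2)
    (f := fun x => (f x, g x)) this (hf.prodMk hg)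

theorem continuous_boundD (κ : ℝ) {ε : ℝ → ℝ} (hε : Continuous ε) :
    Continuous fun p : ℝ × ℝ => boundD κ ε p.1 p.2 := by
  have hi : Continuous fun x : ℝ => ∫ τ in (0 : ℝ)..x, ε τ :=
    intervalIntegral.continuous_primitive (fun a b => hε.intervalIntegrable a b) 0
  refine (Continuous.div_const ?_ _).add ((hi.comp continuous_snd).sub (hi.comp continuous_fst))
  refine intervalIntegral.continuous_parametric_intervalIntegral_of_continuous'
    (f := fun (p : ℝ × ℝ) θ => kernD p.1 p.2 θ * kernWeight κ ε p.1 θ) ?_ _ _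
  have := continuous_kernWeight κ hε (α := (ℝ × ℝ) × ℝ) (f := fun p => p.1.1) (g := fun p => p.2)
    (by fun_prop) (by fun_prop)
  unfold Function.uncurry
  fun_prop

theorem continuous_boundG (κ : ℝ) {ε : ℝ → ℝ} (hε : Continuous ε) :
    Continuous fun p : ℝ × ℝ => boundG κ ε p.1 p.2 := by
  have hi : Continuous fun x : ℝ => ∫ τ in (0 : ℝ)..x, ε τ :=
    intervalIntegral.continuous_primitive (fun a b => hε.intervalIntegrable a b) 0
  refine (Continuous.div_const ?_ _).add ((hi.comp continuous_snd).sub (hi.comp continuous_fst))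
  refine intervalIntegral.continuous_parametric_intervalIntegral_of_continuous'
    (f := fun (p : ℝ × ℝ) θ => kernG p.1 p.2 θ * kernWeight κ ε p.1 θ) ?_ _ _
  have := continuous_kernWeight κ hε (α := (ℝ × ℝ) × ℝ) (f := fun p => p.1.1) (g := fun p => p.2)
    (by fun_prop) (by fun_prop)
  unfold Function.uncurry
  fun_prop

theorem boundD_self (κ : ℝ) (ε : ℝ → ℝ) (s : ℝ) : boundD κ ε s s = 0 := by
  simp [boundD, kernD]

theorem boundG_zero (κ : ℝ) (ε : ℝ → ℝ) (t : ℝ) :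
    boundG κ ε 0 t = κ + ∫ τ in (0 : ℝ)..t, ε τ := by
  simp [boundG, kernWeight, integral_kernG_zero, Real.pi_ne_zero]

theorem hasDerivAt_boundD (κ : ℝ) {ε : ℝ → ℝ} (hε : Continuous ε) (s t : ℝ) :
    HasDerivAt (fun x => boundD κ ε s x) (boundG κ ε s t + ε t - boundD κ ε s t) t := by
  have hw := continuous_kernWeight κ hε (α := ℝ × ℝ) (f := fun _ => s) (g := fun p => p.2)
    (by fun_prop) (by fun_prop)
  have hw' := continuous_kernWeight κ hε (α := ℝ) (f := fun _ => s) (g := fun p => p)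
    (by fun_prop) (by fun_prop)
  have h1 := hasDerivAt_intervalIntegral_of_continuous
    (F := fun x θ => kernD s x θ * kernWeight κ ε s θ)
    (F' := fun x θ => (kernG s x θ - kernD s x θ) * kernWeight κ ε s θ)
    (by unfold Function.uncurry; fun_prop) (by unfold Function.uncurry; fun_prop)
    (fun x θ => (hasDerivAt_kernD s x θ).mul_const _) 0 Real.pi t
  have h2 := hε.integral_hasStrictDerivAt 0 t |>.hasDerivAt
  refine ((h1.div_const Real.pi).add (h2.sub_const _)).congr_deriv ?_
  simp only [sub_mul]
  rw [intervalIntegral.integral_sub (Continuous.intervalIntegrable (by fun_prop) _ _)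
    (Continuous.intervalIntegrable (by fun_prop) _ _)]
  unfold boundG boundD
  ring

/-- Translation along the diagonal fixes `t - s`, so it only rescales the exponential factor. This
is what makes the integral in `kernWeight` a Duhamel term. -/
theorem kernG_mul_exp (s t r θ : ℝ) :
    kernG s t θ * Real.exp ((r + r) * (1 - Real.cos θ)) = kernG (s - r) (t - r) θ := by
  unfold kernG
  rw [mul_right_comm, ← Real.exp_add]
  ring_nf

theorem hasDerivAt_kernWeight (κ : ℝ) {ε : ℝ → ℝ} (hε : Continuous ε) (s θ : ℝ) :
    HasDerivAt (fun x => kernWeight κ ε x θ)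
      (2 * (ε s * Real.exp ((s + s) * (1 - Real.cos θ)))) s := by
  have : Continuous fun τ => ε τ * Real.exp ((τ + τ) * (1 - Real.cos θ)) := by fun_prop
  exact ((this.integral_hasStrictDerivAt 0 s).hasDerivAt.const_mul 2).const_add κ

theorem hasDerivAt_boundG (κ : ℝ) {ε : ℝ → ℝ} (hε : Continuous ε) (s t : ℝ) :
    HasDerivAt (fun x => boundG κ ε x t) (boundD κ ε s t + ε s - boundG κ ε s t) s := by
  have hw := continuous_kernWeight κ hε (α := ℝ × ℝ) (f := fun p => p.1) (g := fun p => p.2)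
    (by fun_prop) (by fun_prop)
  have hw' := continuous_kernWeight κ hε (α := ℝ) (f := fun _ => s) (g := fun p => p)
    (by fun_prop) (by fun_prop)
  have h1 := hasDerivAt_intervalIntegral_of_continuous
    (F := fun x θ => kernG x t θ * kernWeight κ ε x θ)
    (F' := fun x θ => (kernD x t θ - kernG x t θ) * kernWeight κ ε x θ +
      kernG x t θ * (2 * (ε x * Real.exp ((x + x) * (1 - Real.cos θ)))))
    (by unfold Function.uncurry; fun_prop) (by unfold Function.uncurry; fun_prop)
    (fun x θ => (hasDerivAt_kernG x t θ).mul (hasDerivAt_kernWeight κ hε x θ)) 0 Real.pi s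
  have h2 := hε.integral_hasStrictDerivAt 0 s |>.hasDerivAt
  refine ((h1.div_const Real.pi).add (h2.const_sub _)).congr_deriv ?_
  -- The derivative of the weight contributes `2 ε s` after integration over `θ`; the term `-∫₀ˢ ε`
  -- takes one `ε s` back, leaving the required source.
  have e : ∀ θ, kernG s t θ * (2 * (ε s * Real.exp ((s + s) * (1 - Real.cos θ)))) =
      2 * ε s * kernG 0 (t - s) θ := fun θ => by
    rw [← sub_self s, ← kernG_mul_exp]
    ring
  simp only [sub_mul, e]
  rw [intervalIntegral.integral_add (Continuous.intervalIntegrable (by fun_prop) _ _)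
    (Continuous.intervalIntegrable (by fun_prop) _ _),
    intervalIntegral.integral_sub (Continuous.intervalIntegrable (by fun_prop) _ _)
    (Continuous.intervalIntegrable (by fun_prop) _ _), intervalIntegral.integral_const_mul,
    integral_kernG_zero]
  unfold boundG boundD
  have := Real.pi_ne_zero
  field_simp
  ring

/-- By translation, each source instant `τ` contributes a diagonal kernel at time `t - τ`; Fubini
reduces everything to `integral_kernG_self_le`. -/
theorem boundG_self_le {κ : ℝ} (hκ : 0 ≤ κ) {ε : ℝ → ℝ} (hε : Continuous ε) (h0 : ∀ t, 0 ≤ ε t)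
    {t : ℝ} (ht : 0 ≤ t) :
    boundG κ ε t t ≤ κ * sigmaFn t + ∫ s in (0 : ℝ)..t, 2 * ε s * sigmaFn (t - s) := by
  have e : ∀ θ, kernG t t θ * kernWeight κ ε t θ = κ * kernG t t θ +
      ∫ τ in (0 : ℝ)..t, 2 * ε τ * kernG (t - τ) (t - τ) θ := fun θ => by
    unfold kernWeight
    rw [mul_add, mul_comm _ κ, mul_left_comm, ← intervalIntegral.integral_const_mul,
      ← intervalIntegral.integral_const_mul]
    congr 1
    refine intervalIntegral.integral_congr fun τ _ => ?_
    simp only [← kernG_mul_exp]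
    ring
  have hc : Continuous (Function.uncurry fun θ τ => 2 * ε τ * kernG (t - τ) (t - τ) θ) := by
    unfold Function.uncurry
    fun_prop
  have hswap : ∫ θ in (0 : ℝ)..Real.pi, ∫ τ in (0 : ℝ)..t, 2 * ε τ * kernG (t - τ) (t - τ) θ =
      ∫ τ in (0 : ℝ)..t, ∫ θ in (0 : ℝ)..Real.pi, 2 * ε τ * kernG (t - τ) (t - τ) θ :=
    intervalIntegral_intervalIntegral_swap <|
      (hc.continuousOn.integrableOn_compact (isCompact_uIcc.prod isCompact_uIcc)).mono_set
        (prod_mono uIoc_subset_uIcc uIoc_subset_uIcc)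
  have hle : ∫ τ in (0 : ℝ)..t, ∫ θ in (0 : ℝ)..Real.pi, 2 * ε τ * kernG (t - τ) (t - τ) θ ≤
      ∫ τ in (0 : ℝ)..t, Real.pi * (2 * ε τ * sigmaFn (t - τ)) := by
    refine intervalIntegral.integral_mono_on ht (Continuous.intervalIntegrable ?_ _ _)
      (Continuous.intervalIntegrable (by fun_prop) _ _) fun τ hτ => ?_
    · exact intervalIntegral.continuous_parametric_intervalIntegral_of_continuous'
        (by unfold Function.uncurry; fun_prop) _ _
    · rw [intervalIntegral.integral_const_mul]
      have := mul_le_mul_of_nonneg_left (integral_kernG_self_le (sub_nonneg.2 hτ.2))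
        (mul_nonneg zero_le_two (h0 τ))
      linarith
  rw [intervalIntegral.integral_const_mul] at hle
  unfold boundG
  rw [sub_self, add_zero, div_le_iff₀ Real.pi_pos]
  simp only [e]
  rw [intervalIntegral.integral_add (Continuous.intervalIntegrable (by fun_prop) _ _)
    (Continuous.intervalIntegrable
      (intervalIntegral.continuous_parametric_intervalIntegral_of_continuous' hc _ _) _ _),
    intervalIntegral.integral_const_mul, hswap]
  have := mul_le_mul_of_nonneg_left (integral_kernG_self_le ht) hκ
  linarith

/-! ### Maximum principle for the comparison system. -/

theorem HasDerivAt.nonneg_of_forall_le_left {h : ℝ → ℝ} {h' x y : ℝ} (hd : HasDerivAt h h' x)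
    (hyx : y < x) (hle : ∀ r ∈ Ico y x, h r ≤ h x) : 0 ≤ h' := by
  have ht := (hasDerivWithinAt_iff_tendsto_slope' (self_notMem_Iio (a := x))).1
    (hd.hasDerivWithinAt (s := Iio x))
  refine ge_of_tendsto ht ?_
  filter_upwards [Ico_mem_nhdsLT hyx] with r hr
  rw [slope_def_field]
  exact div_nonneg_of_nonpos (sub_nonpos.2 (hle r hr)) (sub_nonpos.2 hr.2.le)

section Comparison

variable {X : Type*} [NormedAddCommGroup X] [NormedSpace ℝ X]

/-- If `exp (-r) * (‖v r‖ - g r)` is maximal at the right end of an interval, then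
the derivatives of `v` and `g` there are constrained by a norming functional of `v x`. -/
theorem exists_norming_functional_of_max {v : ℝ → X} {g : ℝ → ℝ} {v' : X} {g' x y c : ℝ}
    (hv : HasDerivAt v v' x) (hg : HasDerivAt g g' x) (hyx : y < x)
    (hle : ∀ r ∈ Ico y x,
      Real.exp (-(c + r)) * (‖v r‖ - g r) ≤ Real.exp (-(c + x)) * (‖v x‖ - g x)) :
    ∃ l : StrongDual ℝ X, (∀ w, l w ≤ ‖w‖) ∧ l (v x) = ‖v x‖ ∧
      ‖v x‖ - g x ≤ l v' - g' := by
  obtain ⟨l, hl, hlv⟩ := exists_dual_vector'' ℝ (v x)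
  have hlv : l (v x) = ‖v x‖ := hlv
  have hlw : ∀ w, l w ≤ ‖w‖ := fun w =>
    (le_abs_self _).trans (by simpa using l.le_of_opNorm_le hl w)
  refine ⟨l, hlw, hlv, ?_⟩
  have h1 : HasDerivAt (fun r => Real.exp (-(c + r))) (Real.exp (-(c + x)) * -1) x :=
    ((hasDerivAt_id x).const_add c).neg.exp
  have h2 : HasDerivAt (fun r => l (v r)) (l v') x := l.hasFDerivAt.comp_hasDerivAt x hv
  have h3 := (h1.mul (h2.sub hg)).nonneg_of_forall_le_left hyx fun r hr => by
    simp only [Pi.mul_apply, Pi.sub_apply, hlv]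
    refine le_trans ?_ (hle r hr)
    exact mul_le_mul_of_nonneg_left (sub_le_sub_right (hlw _) _) (Real.exp_pos _).le
  simp only [Pi.sub_apply, hlv] at h3
  have h4 : 0 ≤ Real.exp (-(c + x)) * (l v' - g' - (‖v x‖ - g x)) := by linarith
  linarith [nonneg_of_mul_nonneg_right h4 (Real.exp_pos _)]

variable {T : X → X} {f u : ℝ → X} {ε : ℝ → ℝ} {κ : ℝ}

/-- One-variable version of the maximum principle: at a positive weighted maximum the excess would
be at most `0`, since `T` does not increase the distance to `p`. -/
theorem norm_sub_fixedPoint_le (hT : LipschitzWith 1 T)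
    (hu : ∀ t, 0 ≤ t → HasDerivWithinAt u (T (u t) - u t + f t) (Ici 0) t)
    (hε : Continuous ε) (hfε : ∀ t, 0 ≤ t → ‖f t‖ ≤ ε t) {p : X} (hp : T p = p) {t : ℝ}
    (ht : 0 ≤ t) : ‖u t - p‖ ≤ ‖u 0 - p‖ + ∫ τ in (0 : ℝ)..t, ε τ := by
  have huc : ContinuousOn u (Ici 0) := fun t ht => (hu t ht).continuousWithinAt
  have hi : Continuous fun x : ℝ => ∫ τ in (0 : ℝ)..x, ε τ :=
    intervalIntegral.continuous_primitive (fun a b => hε.intervalIntegrable a b) 0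
  set g : ℝ → ℝ := fun r => ‖u 0 - p‖ + ∫ τ in (0 : ℝ)..r, ε τ with hg
  have hc : ContinuousOn (fun r => Real.exp (-(0 + r)) * (‖u r - p‖ - g r)) (Icc 0 t) := by
    have := huc.mono (Icc_subset_Ici_self : Icc 0 t ⊆ Ici 0)
    fun_prop
  obtain ⟨x, hx, hmax⟩ := isCompact_Icc.exists_isMaxOn (nonempty_Icc.2 ht) hc
  by_contra! hlt
  have hpos : 0 < Real.exp (-(0 + x)) * (‖u x - p‖ - g x) :=
    (mul_pos (Real.exp_pos _) (sub_pos.2 hlt)).trans_le (hmax (right_mem_Icc.2 ht))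
  have hpos' := pos_of_mul_pos_right hpos (Real.exp_pos _).le
  have hx0 : 0 < x := by
    refine lt_of_le_of_ne hx.1 fun h => ?_
    rw [← h] at hpos'
    simp [hg] at hpos'
  obtain ⟨l, hl, hlx, hle⟩ := exists_norming_functional_of_max (c := 0)
    (((hu x hx.1).hasDerivAt (Ici_mem_nhds hx0)).sub_const p)
    ((hε.integral_hasStrictDerivAt 0 x).hasDerivAt.const_add ‖u 0 - p‖) hx0
    (fun r hr => hmax ⟨hr.1, hr.2.le.trans hx.2⟩)
  have h1 := hl (T (u x) - p)
  have h2 := (hl (f x)).trans (hfε x hx.1)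
  have h3 : ‖T (u x) - p‖ ≤ ‖u x - p‖ := by
    simpa [hp] using hT.norm_sub_le (u x) p
  have e : T (u x) - u x + f x = (T (u x) - p) - (u x - p) + f x := by abel
  rw [e, map_add, map_sub, hlx] at hle
  linarith

theorem norm_sub_le_boundG (hT : LipschitzWith 1 T)
    (hu : ∀ t, 0 ≤ t → HasDerivWithinAt u (T (u t) - u t + f t) (Ici 0) t)
    (hε : Continuous ε) (hfε : ∀ t, 0 ≤ t → ‖f t‖ ≤ ε t)
    (hb : ∀ t, 0 ≤ t → ‖T (u t) - u 0‖ ≤ κ + ∫ τ in (0 : ℝ)..t, ε τ)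
    {s t : ℝ} (hs : 0 ≤ s) (hst : s ≤ t) : ‖T (u t) - u s‖ ≤ boundG κ ε s t := by
  have huc : ContinuousOn u (Ici 0) := fun t ht => (hu t ht).continuousWithinAt
  -- Moving left in either variable along the segments used below stays in this triangle, so left
  -- derivatives suffice.
  set K : Set (ℝ × ℝ) := {p | 0 ≤ p.1 ∧ p.1 ≤ p.2 ∧ p.2 ≤ t} with hK
  have hKc : IsCompact K := by
    refine (isCompact_Icc.prod isCompact_Icc : IsCompact (Icc 0 t ×ˢ Icc 0 t)).of_isClosed_subset
      ?_ ?_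
    · exact (isClosed_le continuous_const continuous_fst).inter
        ((isClosed_le continuous_fst continuous_snd).inter
          (isClosed_le continuous_snd continuous_const))
    · rintro ⟨a, b⟩ ⟨h1, h2, h3⟩
      exact ⟨⟨h1, h2.trans h3⟩, h1.trans h2, h3⟩
  have hu1 : ContinuousOn (fun p : ℝ × ℝ => u p.1) K :=
    huc.comp continuous_fst.continuousOn fun p hp => hp.1
  have hu2 : ContinuousOn (fun p : ℝ × ℝ => u p.2) K :=
    huc.comp continuous_snd.continuousOn fun p hp => hp.1.trans hp.2.1
  have hTu2 : ContinuousOn (fun p : ℝ × ℝ => T (u p.2)) K := hT.continuous.comp_continuousOn hu2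
  have hD := continuous_boundD κ hε
  have hG := continuous_boundG κ hε
  -- The factor `exp(-(s+t))` adds a damping term that makes the inequality at a positive maximum
  -- strict.
  set A : ℝ × ℝ → ℝ := fun p => Real.exp (-(p.1 + p.2)) * (‖u p.2 - u p.1‖ - boundD κ ε p.1 p.2)
    with hA
  set B : ℝ × ℝ → ℝ := fun p =>
    Real.exp (-(p.1 + p.2)) * (‖T (u p.2) - u p.1‖ - boundG κ ε p.1 p.2) with hB
  have hAc : ContinuousOn A K := (Real.continuous_exp.comp (continuous_fst.add continuous_snd).neg).continuousOn.mul
    ((hu2.sub hu1).norm.sub hD.continuousOn)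
  have hBc : ContinuousOn B K := (Real.continuous_exp.comp (continuous_fst.add continuous_snd).neg).continuousOn.mul
    ((hTu2.sub hu1).norm.sub hG.continuousOn)
  have hmem : (s, t) ∈ K := ⟨hs, hst, le_rfl⟩
  obtain ⟨⟨a, b⟩, hab, hmax⟩ := hKc.exists_isMaxOn ⟨_, hmem⟩ (hAc.sup hBc)
  have hmaxA : ∀ p ∈ K, A p ≤ max (A (a, b)) (B (a, b)) := fun p hp =>
    (le_max_left _ _).trans (hmax hp)
  have hmaxB : ∀ p ∈ K, B p ≤ max (A (a, b)) (B (a, b)) := fun p hp =>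
    (le_max_right _ _).trans (hmax hp)
  by_contra! hlt
  have hpos : 0 < max (A (a, b)) (B (a, b)) :=
    (mul_pos (Real.exp_pos _) (sub_pos.2 hlt)).trans_le (hmaxB _ hmem)
  obtain ⟨ha0, hab', hbt⟩ := hab
  have hb0 := ha0.trans hab'
  simp only at ha0 hab' hbt hb0
  have hTab : ‖T (u b) - T (u a)‖ ≤ ‖u b - u a‖ := by simpa using hT.norm_sub_le (u b) (u a)
  rcases le_total (B (a, b)) (A (a, b)) with hBA | hBA
  · rw [max_eq_left hBA] at hpos hmaxA
    have hpos' := pos_of_mul_pos_right hpos (Real.exp_pos _).le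
    have hBA' := le_of_mul_le_mul_left hBA (Real.exp_pos _)
    simp only at hpos' hBA'
    have hlt' : a < b := by
      refine lt_of_le_of_ne hab' fun h => ?_
      rw [h, boundD_self] at hpos'
      simp at hpos'
    obtain ⟨l, hl, hlx, hle⟩ := exists_norming_functional_of_max (c := a)
      (((hu b hb0).hasDerivAt (Ici_mem_nhds (ha0.trans_lt hlt'))).sub_const (u a))
      (hasDerivAt_boundD κ hε a b) hlt'
      (fun r hr => hmaxA (a, r) ⟨ha0, hr.1, hr.2.le.trans hbt⟩)
    -- Let `α`, `β` be the unweighted excesses in `A`, `B` at `(a, b)`. The functional gives `2α ≤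
    -- β`, contradicting `β ≤ α` and `α > 0`.
    have h1 := hl (T (u b) - u a)
    have h2 := (hl (f b)).trans (hfε b hb0)
    have e : T (u b) - u b + f b = (T (u b) - u a) - (u b - u a) + f b := by abel
    rw [e, map_add, map_sub, hlx] at hle
    linarith
  · rw [max_eq_right hBA] at hpos hmaxB
    have hpos' := pos_of_mul_pos_right hpos (Real.exp_pos _).le
    have hBA' := le_of_mul_le_mul_left hBA (Real.exp_pos _)
    simp only at hpos' hBA'
    have hlt' : 0 < a := by
      refine lt_of_le_of_ne ha0 fun h => ?_
      rw [← h, boundG_zero] at hpos'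
      linarith [hb b hb0]
    obtain ⟨l, hl, hlx, hle⟩ := exists_norming_functional_of_max (c := b)
      (((hu a ha0).hasDerivAt (Ici_mem_nhds hlt')).const_sub (T (u b)))
      (hasDerivAt_boundG κ hε a b) hlt'
      (fun r hr => by
        have := hmaxB (r, b) ⟨hr.1, hr.2.le.trans hab', hbt⟩
        simpa only [hB, add_comm b] using this)
    -- Symmetrically `2β ≤ α`, now using nonexpansiveness, against `α ≤ β` and `β > 0`.
    have h1 := (hl (T (u b) - T (u a))).trans hTab
    have h2 := (hl (-f a)).trans ((norm_neg (f a)).le.trans (hfε a ha0))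
    have e : -(T (u a) - u a + f a) = (T (u b) - T (u a)) - (T (u b) - u a) + -f a := by abel
    rw [e, map_add, map_sub, hlx] at hle
    linarith

end Comparison

/-! ### Decay of the bound and the main theorem. -/

/-- Dominated convergence: `σ(t - s) → 0` for each fixed `s`, with majorant `2‖ε‖` because `σ ≤ 1`.
-/
theorem tendsto_integral_mul_sigmaFn {ε : ℝ → ℝ} (hε : IntegrableOn ε (Ioi 0)) :
    Tendsto (fun t => ∫ s in (0 : ℝ)..t, 2 * ε s * sigmaFn (t - s)) atTop (𝓝 0) := by
  have h : Tendsto (fun t => ∫ s in Ioi (0 : ℝ),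
      (Iic t).indicator (fun s => 2 * ε s * sigmaFn (t - s)) s) atTop
      (𝓝 (∫ _ in Ioi (0 : ℝ), (0 : ℝ))) := by
    refine tendsto_integral_filter_of_dominated_convergence (fun s => 2 * ‖ε s‖)
      (Eventually.of_forall fun t => ?_) (Eventually.of_forall fun t => ?_)
      (hε.norm.const_mul 2) ?_
    · refine (AEStronglyMeasurable.mul (hε.aestronglyMeasurable.const_mul 2) ?_).indicator
        measurableSet_Iic
      exact Continuous.aestronglyMeasurable (by fun_prop)
    · refine Eventually.of_forall fun s => (norm_indicator_le_norm_self _ _).trans ?_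
      rw [norm_mul, norm_mul, Real.norm_two, Real.norm_of_nonneg (sigmaFn_nonneg _)]
      exact mul_le_of_le_one_right (by positivity) (sigmaFn_le_one _)
    · refine Eventually.of_forall fun s => ?_
      have h1 : Tendsto (fun t => 2 * ε s * sigmaFn (t - s)) atTop (𝓝 (2 * ε s * 0)) :=
        (tendsto_sigmaFn.comp (tendsto_atTop_add_const_right _ (-s) tendsto_id)).const_mul _
      rw [mul_zero] at h1
      refine h1.congr' ?_
      filter_upwards [eventually_ge_atTop s] with t ht
      rw [indicator_of_mem (mem_Iic.2 ht)]
  rw [integral_zero] at h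
  refine h.congr' ?_
  filter_upwards [eventually_ge_atTop 0] with t ht
  rw [intervalIntegral.integral_of_le ht, setIntegral_indicator measurableSet_Iic, Ioi_inter_Iic]

theorem mainTheorem8 {X : Type*} [NormedAddCommGroup X] [NormedSpace ℝ X]
    (T : X → X) (hT : LipschitzWith 1 T)
    (f : ℝ → X) (hf : ContinuousOn f (Ici 0))
    (x₀ : X) (u : ℝ → X) (hu : IsEvolutionSolution T f x₀ u)
    (ε : ℝ → ℝ) (hε : ContinuousOn ε (Ici 0)) (hfε : ∀ t : ℝ, 0 ≤ t → ‖f t‖ ≤ ε t)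
    (κ : ℝ) (hκ : BoundedRangeCondition T x₀ κ ∨ FixedPointCondition T x₀ ε κ) :
    (∀ t : ℝ, 0 ≤ t →
      ‖derivWithin u (Ici 0) t‖ ≤
        κ * sigmaFn t + (∫ s in (0 : ℝ)..t, 2 * ε s * sigmaFn (t - s)) + ε t) ∧
    (Tendsto ε atTop (𝓝 0) → IntegrableOn ε (Ioi 0) →
      Tendsto (fun t : ℝ => ‖derivWithin u (Ici 0) t‖) atTop (𝓝 0)) := by
  have hε0 : ∀ t, 0 ≤ t → 0 ≤ ε t := fun t ht => (norm_nonneg _).trans (hfε t ht)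
  have hderiv : ∀ t, 0 ≤ t → derivWithin u (Ici 0) t = T (u t) - u t + f t := fun t ht => by
    rw [← hu.equation t ht]
    abel
  have hu' : ∀ t, 0 ≤ t → HasDerivWithinAt u (T (u t) - u t + f t) (Ici 0) t := fun t ht => by
    rw [← hderiv t ht]
    exact (hu.differentiableOn t ht).hasDerivWithinAt
  -- Constant extension of `ε` to negative times, continuous on all of `ℝ` as the two-sided
  -- derivative formulas require.
  set η : ℝ → ℝ := fun t => ε (max t 0) with hη
  have hηε : ∀ t, 0 ≤ t → η t = ε t := fun t ht => by simp [hη, ht]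
  have hηc : Continuous η := hε.comp_continuous (by fun_prop) fun t => le_max_right t 0
  have hη0 : ∀ t, 0 ≤ η t := fun t => hε0 _ (le_max_right t 0)
  have hfη : ∀ t, 0 ≤ t → ‖f t‖ ≤ η t := fun t ht => (hfε t ht).trans_eq (hηε t ht).symm
  have hint : ∀ t, 0 ≤ t → 0 ≤ ∫ τ in (0 : ℝ)..t, η τ := fun t ht =>
    intervalIntegral.integral_nonneg ht fun τ _ => hη0 τ
  have hκ0 : 0 ≤ κ ∧ ∀ t, 0 ≤ t → ‖T (u t) - u 0‖ ≤ κ + ∫ τ in (0 : ℝ)..t, η τ := by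
    rw [hu.initial]
    rcases hκ with h | h
    · have hbdd : BddAbove (range fun x => ‖T x - x₀‖) := by
        obtain ⟨C, hC⟩ := h.bounded_range.exists_norm_le
        refine ⟨C + ‖x₀‖, ?_⟩
        rintro _ ⟨x, rfl⟩
        exact (norm_sub_le _ _).trans (add_le_add_left (hC _ (mem_range_self x)) _)
      have hle : ∀ x, ‖T x - x₀‖ ≤ κ := fun x => by
        rw [h.kappa_eq]
        exact le_ciSup hbdd x
      exact ⟨(norm_nonneg _).trans (hle x₀), fun t ht => by linarith [hle (u t), hint t ht]⟩
    · have hS : 0 ≤ ∫ t in Ioi (0 : ℝ), ε t :=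
        setIntegral_nonneg measurableSet_Ioi fun t ht => hε0 t (le_of_lt ht)
      have hdist : 0 ≤ Metric.infDist x₀ (Function.fixedPoints T) := Metric.infDist_nonneg
      refine ⟨by rw [h.kappa_eq]; positivity, fun t ht => ?_⟩
      -- The factor 2 in `κ`: `‖T (u t) - x₀‖ ≤ ‖u t - p‖ + ‖p - x₀‖`, where the first term is again
      -- at most `‖x₀ - p‖ + ∫₀ᵗ η`. Halving isolates the distance, so the infimum over `p` can be
      -- taken.
      have hle : (‖T (u t) - x₀‖ - ∫ τ in (0 : ℝ)..t, η τ) / 2 ≤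
          Metric.infDist x₀ (Function.fixedPoints T) := by
        refine (Metric.le_infDist h.fix_nonempty).2 fun p hp => ?_
        have hp' : T p = p := hp
        have h1 := norm_sub_fixedPoint_le hT hu' hηc hfη hp' ht
        have h2 : ‖T (u t) - p‖ ≤ ‖u t - p‖ := by simpa [hp'] using hT.norm_sub_le (u t) p
        have h3 := norm_sub_le_norm_sub_add_norm_sub (T (u t)) p x₀
        rw [hu.initial] at h1
        rw [norm_sub_rev p x₀] at h3
        rw [dist_eq_norm]
        linarith
      rw [h.kappa_eq]
      linarith
  have main : ∀ t : ℝ, 0 ≤ t → ‖derivWithin u (Ici 0) t‖ ≤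
      κ * sigmaFn t + (∫ s in (0 : ℝ)..t, 2 * ε s * sigmaFn (t - s)) + ε t := fun t ht => by
    have h1 := norm_sub_le_boundG hT hu' hηc hfη hκ0.2 ht le_rfl
    have h2 := boundG_self_le hκ0.1 hηc hη0 ht
    have h3 : ∫ s in (0 : ℝ)..t, 2 * η s * sigmaFn (t - s) =
        ∫ s in (0 : ℝ)..t, 2 * ε s * sigmaFn (t - s) := by
      refine intervalIntegral.integral_congr fun s hs => ?_
      rw [uIcc_of_le ht] at hs
      simp only [hηε s hs.1]
    rw [hderiv t ht]
    linarith [norm_add_le (T (u t) - u t) (f t), hfε t ht]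
  refine ⟨main, fun hlim hi => ?_⟩
  have hlim' := ((tendsto_sigmaFn.const_mul κ).add (tendsto_integral_mul_sigmaFn hi)).add hlim
  rw [mul_zero, add_zero, add_zero] at hlim'
  refine squeeze_zero' (Eventually.of_forall fun t => norm_nonneg _) ?_ hlim'
  filter_upwards [eventually_ge_atTop 0] with t ht using main t ht
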